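/- **Lemma 3.3.** Let $\mathcal G$ be a finite connected network with vertices $V^1,\dots,V^n$ and edges $E^1,\dots,E^m$. Each closed edge $\overline{E^j}$ is identified with an interval $[0,L_j]$, $L_j>0$, oriented from its initial vertex $\alpha(E^j)$ (at $0$) to its terminal vertex $\omega(E^j)$ (at $L_j$). Let $\Omega_{\mathcal G}$ be the set of all points of the network (the closed edges and vertices, glued at the end points). Fix $\kappa>0$. *Data.* For $l\in\{0,1\}$ let $\rho_l^j$ be finite non-negative Borel measures on $\overline{E^j}$ $(1\le j\le m)$ and $\gamma_l^i\ge 0$ $(1\le i\le n)$ be such that $\varsigma_l=\sum_j\rho_l^j+\sum_i\gamma_l^i\delta_{V^i}$ is a probability measure on $\Omega_{\mathcal G}$. *Continuity equation.* Let $\mathcal{CE}(\rho_0,\rho_1,\gamma_0,\gamma_1)$ be the set of all $(\rho,F,\gamma,f)$, where $\rho^j,F^j$ are finite signed Borel measures on $[0,1]\times\overline{E^j}$ and $\gamma^i,f^i\in L^1(0,1)$, such that $$\sum_{j=1}^m\iint_{[0,1]\times\overline{E^j}}\big(\partial_t\varphi\,d\rho^j+\partial_x\varphi\,dF^j\big)-\sum_{i=1}^n\int_0^1\varphi_t(V^i)f^i_t\,dt=\sum_{j=1}^m\Big[\int_{\overline{E^j}}\varphi_1\,d\rho^j_1-\int_{\overline{E^j}}\varphi_0\,d\rho^j_0\Big]$$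 for all functions $\varphi$ on $[0,1]\times\Omega_{\mathcal G}$ that are $C^1$ on $[0,1]\times\overline{E^j}$ for every $j$ and $C^1$ in time at every vertex, and $$\sum_{i=1}^n\int_0^1\partial_t\psi^i_t\,\gamma^i_t\,dt=-\sum_{i=1}^n\int_0^1\psi^i_t f^i_t\,dt+\sum_{i=1}^n\big(\psi^i_1\gamma^i_1-\psi^i_0\gamma^i_0\big)$$ for all $\psi^1,\dots,\psi^n\in C^1([0,1])$, where in the last sum $\gamma^i_0,\gamma^i_1$ are the given data. (This is the weak form of $\partial_t\rho^j+\partial_xF^j=0$ on $E^j$ and $\partial_t\gamma^i=f^i$ at $V^i$, where $f^i$ is the sum of the outward fluxes at $V^i$ of the edges that start or end there.) *Action.* Let $A(a,b)=\frac{|b|^2}{2a}$ if $a>0$, $A(0,0)=0$, and $A(a,b)=+\infty$ otherwise, and let $$\mathcal A(\rho,F,\gamma,f)=\sum_{j=1}^m\iint_{[0,1]\times\overline{E^j}}A\Big(\frac{d\rho^j}{d\theta^j},\frac{dF^j}{d\theta^j}\Big)\,d\theta^j+\kappa^2\sum_{i=1}^n\int_0^1A(\gamma^i_t,f^i_t)\,dt,$$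 where $\theta^j$ is any finite non-negative Borel measure with $|\rho^j|\ll\theta^j$ and $|F^j|\ll\theta^j$ (for example $\theta^j=|\rho^j|+|F^j|$; the value does not depend on the choice). *Claim.* The quantity $$\mathcal W_\kappa^2(\rho_0,\rho_1,\gamma_0,\gamma_1)=\inf_{(\rho,F,\gamma,f)\in\mathcal{CE}(\rho_0,\rho_1,\gamma_0,\gamma_1)}\mathcal A(\rho,F,\gamma,f)$$ is finite for all such data; that is, there is a weak solution of the continuity equation that connects them and has finite action. -/

import Mathlib

open Set MeasureTheory
open scoped ENNReal NNReal

/-- A finite oriented network with vertices `V^i`, `i : Fin n`, and edges `E^j`, `j : Fin m`. The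
closure of `E^j` is identified with the interval `[0, length j]`, oriented from the vertex `src j`
(at `0`) to the vertex `tgt j` (at `length j`). Loops and parallel edges are allowed. -/
structure Network (n m : ℕ) where
  src : Fin m → Fin n
  tgt : Fin m → Fin n
  length : Fin m → ℝ
  length_pos : ∀ j, 0 < length j

namespace Network

variable {n m : ℕ} (G : Network n m)

/-- Connectedness of the network: any two vertices are joined by a finite chain of edges, whose
orientations are irrelevant. -/
def Connected : Prop :=
  (SimpleGraph.fromRel fun a b : Fin n => ∃ j, G.src j = a ∧ G.tgt j = b).Connected

/-- The closed edge. -/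
abbrev ClosedEdge (j : Fin m) : Type := Icc (0 : ℝ) (G.length j)

/-- Space-time over a closed edge: `[0,1] × closure of E^j`. -/
abbrev EdgeSpaceTime (j : Fin m) : Type := Icc (0 : ℝ) 1 × G.ClosedEdge j

/-- The starting point of a closed edge. -/
def startPt (j : Fin m) : G.ClosedEdge j := ⟨0, le_rfl, (G.length_pos j).le⟩

/-- The end point of a closed edge. -/
def endPt (j : Fin m) : G.ClosedEdge j := ⟨G.length j, (G.length_pos j).le, le_rfl⟩

/-- Gluing of the end points of the closed edges to the vertices. -/
inductive Glue : (Fin n ⊕ (Σ j : Fin m, G.ClosedEdge j)) →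
    (Fin n ⊕ (Σ j : Fin m, G.ClosedEdge j)) → Prop
  | start (j : Fin m) : Glue (Sum.inr ⟨j, G.startPt j⟩) (Sum.inl (G.src j))
  | finish (j : Fin m) : Glue (Sum.inr ⟨j, G.endPt j⟩) (Sum.inl (G.tgt j))

/-- The closed set `Ω_G` of all points of the network: vertices and edges, where the end points of
the edges are glued to the vertices. It carries the quotient `σ`-algebra. -/
abbrev Space : Type := Quot G.Glue

/-- The vertex `V^i` as a point of the network. -/
def vertexPt (i : Fin n) : G.Space := Quot.mk _ (Sum.inl i)

/-- The map of the closed edge `E^j` into the network. -/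
def edgePt (j : Fin m) (x : G.ClosedEdge j) : G.Space := Quot.mk _ (Sum.inr ⟨j, x⟩)

/-- The total density `∑_j ρ^j + ∑_i γ^i δ_{V^i}` on the network, for measures `ρ^j` on the edges
and masses `γ^i` at the vertices. -/
noncomputable def totalDensity (ρ : ∀ j, FiniteMeasure (G.ClosedEdge j)) (γ : Fin n → ℝ≥0) :
    Measure G.Space :=
  ∑ j, ((ρ j : Measure (G.ClosedEdge j)).map (G.edgePt j)) +
    ∑ i, (γ i) • Measure.dirac (G.vertexPt i)

/-- The function of `(t, x)` obtained from `φ` by restriction to the edge `E^j`, where `x` is the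
coordinate on the edge; only its values on `[0,1] × [0, length j]` are relevant. -/
noncomputable def onEdge (φ : ℝ → G.Space → ℝ) (j : Fin m) (t x : ℝ) : ℝ :=
  φ t (G.edgePt j (projIcc 0 (G.length j) (G.length_pos j).le x))

/-- `C^1` functions on `[0,1] × Ω_G`: functions on the network which are `C^1` up to the boundary
on `[0,1]` times every closed edge. They take a single value at each vertex since they are functions
on `Ω_G`; the condition at vertices only matters for vertices without edges. -/
def IsTestFunction (φ : ℝ → G.Space → ℝ) : Prop :=
  (∀ j, ContDiffOn ℝ 1 (fun p : ℝ × ℝ => G.onEdge φ j p.1 p.2)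
    (Icc 0 1 ×ˢ Icc 0 (G.length j))) ∧
  ∀ i, ContDiffOn ℝ 1 (fun t => φ t (G.vertexPt i)) (Icc 0 1)

/-- The time derivative `∂_t φ` on the edge `E^j`. -/
noncomputable def timeDeriv (φ : ℝ → G.Space → ℝ) (j : Fin m) (z : G.EdgeSpaceTime j) : ℝ :=
  derivWithin (fun t => G.onEdge φ j t z.2) (Icc 0 1) z.1

/-- The space derivative `∂_x φ` on the edge `E^j`, with respect to its orientation. -/
noncomputable def spaceDeriv (φ : ℝ → G.Space → ℝ) (j : Fin m) (z : G.EdgeSpaceTime j) : ℝ :=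
  derivWithin (fun x => G.onEdge φ j z.1 x) (Icc 0 (G.length j)) z.2

/-- A time-dependent quadruple `(ρ_t, F_t, γ_t, f_t)`: for each edge, finite signed measures `ρ^j`
and `F^j` on space-time, and for each vertex, integrable functions `γ^i` and `f^i` of time.
Non-negativity of `ρ` and `γ` is enforced by the action, which is infinite otherwise. -/
structure Curve where
  ρ : ∀ j, SignedMeasure (G.EdgeSpaceTime j)
  F : ∀ j, SignedMeasure (G.EdgeSpaceTime j)
  γ : Fin n → ℝ → ℝ
  f : Fin n → ℝ → ℝ
  γ_integrable : ∀ i, IntegrableOn (γ i) (Icc 0 1)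
  f_integrable : ∀ i, IntegrableOn (f i) (Icc 0 1)

/-- The set of weak solutions of the continuity equation
`∂_t ρ^j + ∂_x F^j = 0` on the edges, `∂_t γ^i = f^i` at the vertices, `f^i` being the sum of the
outward fluxes at `V^i` of the edges at `V^i`, with prescribed initial and terminal values. -/
def CE (ρ₀ ρ₁ : ∀ j, FiniteMeasure (G.ClosedEdge j)) (γ₀ γ₁ : Fin n → ℝ≥0) : Set G.Curve :=
  {μ |
    (∀ φ : ℝ → G.Space → ℝ, G.IsTestFunction φ →
      ∑ j, (VectorMeasure.integral (μ.ρ j) (G.timeDeriv φ j)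
              (ContinuousLinearMap.lsmul ℝ ℝ).flip +
            VectorMeasure.integral (μ.F j) (G.spaceDeriv φ j)
              (ContinuousLinearMap.lsmul ℝ ℝ).flip) -
        ∑ i, ∫ t in (0 : ℝ)..1, φ t (G.vertexPt i) * μ.f i t =
      ∑ j, (∫ x, φ 1 (G.edgePt j x) ∂(ρ₁ j : Measure (G.ClosedEdge j)) -
            ∫ x, φ 0 (G.edgePt j x) ∂(ρ₀ j : Measure (G.ClosedEdge j)))) ∧
    (∀ ψ : Fin n → ℝ → ℝ, (∀ i, ContDiffOn ℝ 1 (ψ i) (Icc 0 1)) →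
      ∑ i, ∫ t in (0 : ℝ)..1, derivWithin (ψ i) (Icc 0 1) t * μ.γ i t =
      -∑ i, (∫ t in (0 : ℝ)..1, ψ i t * μ.f i t) +
        ∑ i, (ψ i 1 * (γ₁ i : ℝ) - ψ i 0 * (γ₀ i : ℝ)))}

/-- The action density `A(a, b)`. -/
noncomputable def actionDensity (a b : ℝ) : ℝ≥0∞ :=
  open Classical in
  if 0 < a then ENNReal.ofReal (|b| ^ 2 / (2 * a)) else if a = 0 ∧ b = 0 then 0 else ⊤

/-- The action on one edge, written with the reference measure `θ = |ρ| + |F|`. As `A` is jointly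
1-homogeneous, every other finite `θ` that dominates `|ρ|` and `|F|` gives the same value. -/
noncomputable def edgeAction {X : Type*} [MeasurableSpace X] (ρ F : SignedMeasure X) : ℝ≥0∞ :=
  ∫⁻ z, actionDensity (ρ.rnDeriv (ρ.totalVariation + F.totalVariation) z)
      (F.rnDeriv (ρ.totalVariation + F.totalVariation) z)
    ∂(ρ.totalVariation + F.totalVariation)

variable {G} in
/-- The action functional. -/
noncomputable def Curve.action (κ : ℝ) (μ : G.Curve) : ℝ≥0∞ :=
  ∑ j, edgeAction (μ.ρ j) (μ.F j) +
    ENNReal.ofReal (κ ^ 2) * ∑ i, ∫⁻ t in Icc (0 : ℝ) 1, actionDensity (μ.γ i t) (μ.f i t)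

/-- The quantity `W_κ²`: the infimum of the action over all weak solutions of the continuity
equation; it is `∞` if there is none. -/
noncomputable def W2 (κ : ℝ) (ρ₀ ρ₁ : ∀ j, FiniteMeasure (G.ClosedEdge j))
    (γ₀ γ₁ : Fin n → ℝ≥0) : ℝ≥0∞ :=
  ⨅ μ ∈ G.CE ρ₀ ρ₁ γ₀ γ₁, μ.action κ

end Network

-- A curve of finite action is built explicitly by mixing the two given states with a uniform one,
-- whose spread-out mass pays for the flux. The uniform state consists of `c` times Lebesgue measure
-- on every edge and mass `c` at every vertex, with `c > 0` chosen so that the total mass is one.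
--
-- Fix a vertex `i₀`. By connectedness every state of mass one can be swept to `i₀` by a bounded
-- flux: on an edge, the mass to the right of `x` carries everything to the initial vertex, and
-- constants on the edges carry vertex masses along paths (`Connected.exists_flux`). If the states
-- `k` have fluxes `H k` and the curve is their combination with weights `w k t`, then the flux `∑
-- k, w' k * H k` solves the continuity equation: the point masses at `i₀` cancel because the rates
-- `w' k` sum to zero (`interpolationCurve_edge_equation`).
--
-- The given measures may be singular or vanish on whole edges, so only the uniform part bounds the
-- density from below, by `c * w 2`. The action is therefore finite as soon as `(w' k)² ≤ K * w 2`
-- for all `k`, which makes the quotient flux² / density bounded. The uniform weight must vanish at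
-- both ends, so the rates must vanish there too. Taking `w = (1 - s)², s², 2 s (1 - s)` with the
-- smoothstep `s = 3 t² - 2 t³` achieves this with `K = 72` (`smoothInterpolation_rate_sq_le`); with
-- `s = t` the resulting bound would behave like `1 / t` near `0` and not be integrable.

attribute [local instance] Measure.Subtype.measureSpace

/-! ### Action and integrals for fluxes with a density -/

/-- If the positive part `P` dominates `β λ` with `β > 0` and the flux `g λ` satisfies
`∫ g² / β dλ < ∞`, then the action is finite. -/
theorem Network.edgeAction_lt_top {X : Type*} [MeasurableSpace X] (P μ : Measure X)
    [IsFiniteMeasure P] [IsFiniteMeasure μ] {g : X → ℝ} (hgm : Measurable g) (hg : Integrable g μ)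
    {β : X → ℝ≥0∞} (hβm : Measurable β) (hβtop : ∀ z, β z ≠ ⊤) (hβ : ∀ᵐ z ∂μ, β z ≠ 0)
    (hP : μ.withDensity β ≤ P)
    (hfin : ∫⁻ z, ENNReal.ofReal (g z ^ 2) / β z ∂μ < ⊤) :
    Network.edgeAction P.toSignedMeasure (μ.withDensityᵥ g) < ⊤ := by
  unfold Network.edgeAction
  set θ : Measure X := SignedMeasure.totalVariation P.toSignedMeasure +
    SignedMeasure.totalVariation (μ.withDensityᵥ g) with hθ
  have hPle : P ≤ θ := by
    rw [hθ, SignedMeasure.totalVariation_eq_variation P.toSignedMeasure,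
      Measure.variation_toSignedMeasure]
    exact Measure.le_add_right le_rfl
  have hPθ : P ≪ θ := Measure.absolutelyContinuous_of_le hPle
  -- Since `β` is almost everywhere nonzero, `μ ≪ β μ ≤ P ≪ θ`. Hence mass and flux both have
  -- densities with respect to `θ`, and the signed derivatives below have no singular part.
  have hμP : μ ≪ P :=
    (withDensity_absolutelyContinuous' hβm.aemeasurable hβ).trans
      (Measure.absolutelyContinuous_of_le hP)
  have hμθ : μ ≪ θ := hμP.trans hPθ
  set p := P.rnDeriv θ with hp
  set l := μ.rnDeriv θ with hl
  have hpm : Measurable p := Measure.measurable_rnDeriv _ _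
  have hlm : Measurable l := Measure.measurable_rnDeriv _ _
  have hPp : θ.withDensity p = P := Measure.withDensity_rnDeriv_eq _ _ hPθ
  have hμl : θ.withDensity l = μ := Measure.withDensity_rnDeriv_eq _ _ hμθ
  have hptop : ∀ᵐ z ∂θ, p z < ⊤ := Measure.rnDeriv_lt_top _ _
  have hltop : ∀ᵐ z ∂θ, l z < ⊤ := Measure.rnDeriv_lt_top _ _
  have hρ : (fun z => (p z).toReal) =ᵐ[θ] SignedMeasure.rnDeriv P.toSignedMeasure θ := by
    refine SignedMeasure.eq_rnDeriv 0 _ Measure.integrable_toReal_rnDeriv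
      VectorMeasure.MutuallySingular.zero_left ?_
    rw [zero_add, withDensityᵥ_toReal hpm.aemeasurable]
    · simp only [hPp]
    · rw [← setLIntegral_univ, ← withDensity_apply _ MeasurableSet.univ, hPp]
      exact measure_ne_top _ _
  have hint : Integrable (fun z => (l z).toReal • g z) θ := by
    rw [← integrable_withDensity_iff_integrable_smul' hlm hltop, hμl]
    exact hg
  have hF : (fun z => (l z).toReal • g z) =ᵐ[θ] SignedMeasure.rnDeriv (μ.withDensityᵥ g) θ := by
    refine SignedMeasure.eq_rnDeriv 0 _ hint VectorMeasure.MutuallySingular.zero_left ?_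
    rw [zero_add, withDensityᵥ_smul_eq_withDensityᵥ_withDensity' hlm.aemeasurable hltop hint, hμl]
  -- The comparison of measures `β μ ≤ P`, read off as a comparison of densities.
  have hle : ∀ᵐ z ∂θ, l z * β z ≤ p z := by
    refine ae_le_of_forall_setLIntegral_le_of_sigmaFinite (hlm.mul hβm) fun s hs _ => ?_
    have := hP s
    rw [← hμl, ← withDensity_mul _ hlm hβm, ← hPp, withDensity_apply _ hs,
      withDensity_apply _ hs] at this
    exact this
  have hne : ∀ᵐ z ∂θ, l z ≠ 0 → β z ≠ 0 := by
    rw [← hμl, ae_withDensity_iff hlm] at hβ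
    exact hβ
  refine lt_of_le_of_lt ?_ hfin
  -- With both sides integrated against `θ`, it remains to show `(l g)² / (2 p) ≤ l g² / β`
  -- pointwise, which follows from `l β ≤ p`.
  nth_rewrite 2 [← hμl]
  rw [lintegral_withDensity_eq_lintegral_mul _ hlm (by fun_prop)]
  refine lintegral_mono_ae ?_
  filter_upwards [hρ, hF, hptop, hltop, hle, hne] with z h1 h2 h3 h4 h5 h6
  rw [← h1, ← h2, Network.actionDensity]
  simp only [Pi.mul_apply, smul_eq_mul]
  -- Where `l` vanishes so does the flux, and the action density is `0` whether or not there is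
  -- mass.
  by_cases hl0 : l z = 0
  · simp [hl0]
    by_cases hp0 : 0 < (p z).toReal
    · simp [hp0]
    · have : (p z).toReal = 0 := le_antisymm (not_lt.1 hp0) ENNReal.toReal_nonneg
      simp [this]
  have hb := h6 hl0
  have hlr : 0 < (l z).toReal := ENNReal.toReal_pos hl0 h4.ne
  have hbr : 0 < (β z).toReal := ENNReal.toReal_pos hb (hβtop z)
  have hle' : (l z).toReal * (β z).toReal ≤ (p z).toReal := by
    rw [← ENNReal.toReal_mul]
    exact ENNReal.toReal_mono h3.ne h5
  have hpr : 0 < (p z).toReal := lt_of_lt_of_le (mul_pos hlr hbr) hle'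
  rw [if_pos hpr, ← ENNReal.ofReal_toReal (hβtop z), ← ENNReal.ofReal_div_of_pos hbr]
  nth_rewrite 2 [← ENNReal.ofReal_toReal h4.ne]
  rw [← ENNReal.ofReal_mul hlr.le]
  refine ENNReal.ofReal_le_ofReal ?_
  rw [sq_abs, div_le_iff₀ (by positivity), mul_div_assoc', div_mul_eq_mul_div, le_div_iff₀ hbr]
  nlinarith [mul_le_mul_of_nonneg_left hle' (by positivity : 0 ≤ (l z).toReal * g z ^ 2),
    mul_nonneg (by positivity : 0 ≤ (l z).toReal * g z ^ 2) hpr.le]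

/-- The integral against a signed measure with density. -/
theorem MeasureTheory.Measure.integral_withDensityᵥ {X : Type*} [MeasurableSpace X]
    (μ : Measure X) {g φ : X → ℝ} (hgm : Measurable g) (hg : Integrable g μ)
    (hφ : Integrable (fun z => φ z * g z) μ) :
    VectorMeasure.integral (μ.withDensityᵥ g) φ (ContinuousLinearMap.lsmul ℝ ℝ).flip =
      ∫ z, φ z * g z ∂μ := by
  -- The signed measure is split into the parts with densities `max g 0` and `max (-g) 0`;
  -- integrability of `φ * g` passes to each of them by restriction to a sign set.
  have key : ∀ h : X → ℝ, Measurable h → Integrable (fun z => φ z * h z) μ →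
      Integrable (fun z => φ z * max (h z) 0) μ := by
    intro h hm hi
    have : (fun z => φ z * max (h z) 0) = {z | 0 < h z}.indicator (fun z => φ z * h z) := by
      funext z
      by_cases hz : 0 < h z
      · simp [hz, max_eq_left hz.le]
      · simp [hz, max_eq_right (not_lt.1 hz)]
    rw [this]
    exact hi.indicator (measurableSet_lt measurable_const hm)
  have hi1 := key g hgm hφ
  have hi2 := key (fun z => -g z) hgm.neg (by simpa using hφ.neg)
  have hc : ∀ h : X → ℝ, Measurable h →
      (Integrable φ (μ.withDensity fun z => ENNReal.ofReal (h z)) ↔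
        Integrable (fun z => φ z * max (h z) 0) μ) ∧
      ∫ z, φ z ∂(μ.withDensity fun z => ENNReal.ofReal (h z)) = ∫ z, φ z * max (h z) 0 ∂μ := by
    intro h hm
    constructor
    · rw [integrable_withDensity_iff_integrable_smul' hm.ennreal_ofReal (by simp)]
      simp [ENNReal.toReal_ofReal', mul_comm]
    · rw [integral_withDensity_eq_integral_toReal_smul hm.ennreal_ofReal (by simp)]
      simp [ENNReal.toReal_ofReal', mul_comm]
  have := isFiniteMeasure_withDensity_ofReal hg.2
  have : IsFiniteMeasure (μ.withDensity fun z => ENNReal.ofReal (-g z)) :=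
    isFiniteMeasure_withDensity_ofReal hg.neg.2
  rw [withDensityᵥ_eq_withDensity_pos_part_sub_withDensity_neg_part hg,
    VectorMeasure.integral_sub_vectorMeasure, VectorMeasure.integral_toSignedMeasure,
    VectorMeasure.integral_toSignedMeasure, (hc g hgm).2, (hc (fun z => -g z) hgm.neg).2,
    ← MeasureTheory.integral_sub hi1 hi2]
  · refine integral_congr_ae (Filter.Eventually.of_forall fun z => ?_)
    simp only [← mul_sub]
    rcases le_total 0 (g z) with h | h
    · simp [h]
    · simp [h]
  · rw [VectorMeasure.Integrable, Measure.variation_toSignedMeasure]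
    exact (hc g hgm).1.2 hi1
  · rw [VectorMeasure.Integrable, Measure.variation_toSignedMeasure]
    exact (hc _ hgm.neg).1.2 hi2

/-! ### Path weights in a connected network -/

namespace Network

/-- In a connected network, the difference of the values of a vertex function at two vertices is a
fixed linear combination of its increments along the edges. -/
theorem Connected.exists_weights {n m : ℕ} {G : Network n m} (hG : G.Connected) (a b : Fin n) :
    ∃ c : Fin m → ℝ, ∀ u : Fin n → ℝ, u b - u a = ∑ j, c j * (u (G.tgt j) - u (G.src j)) := by
  have h := hG.preconnected a b
  obtain ⟨p⟩ := h
  induction p with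
  | nil => exact ⟨0, by simp⟩
  | @cons x y z hxy _ ih =>
    obtain ⟨c, hc⟩ := ih
    rw [SimpleGraph.fromRel_adj] at hxy
    classical
    -- The first edge of the walk contributes `1` or `-1`, according to whether it is traversed
    -- along or against its orientation.
    rcases hxy.2 with ⟨j, hj, hj'⟩ | ⟨j, hj, hj'⟩
    · refine ⟨c + Pi.single j 1, fun u => ?_⟩
      simp only [Pi.add_apply, add_mul, Finset.sum_add_distrib, ← hc, Pi.single_apply, ite_mul,
        one_mul, zero_mul, Finset.sum_ite_eq', Finset.mem_univ, if_true, hj, hj']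
      ring
    · refine ⟨c - Pi.single j 1, fun u => ?_⟩
      simp only [Pi.sub_apply, sub_mul, Finset.sum_sub_distrib, ← hc, Pi.single_apply, ite_mul,
        one_mul, zero_mul, Finset.sum_ite_eq', Finset.mem_univ, if_true, hj, hj']
      ring

end Network

/-! ### Calculus and integration on a closed interval -/

instance (a b : ℝ) : IsFiniteMeasure (volume : Measure (Icc a b)) :=
  ⟨by rw [Measure.Subtype.volume_univ measurableSet_Icc.nullMeasurableSet]; simp⟩

theorem integral_Icc_subtype_eq_intervalIntegral {a b : ℝ} (hab : a ≤ b) (f : ℝ → ℝ) :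
    ∫ t : Icc a b, f t = ∫ t in a..b, f t := by
  rw [integral_subtype measurableSet_Icc, integral_Icc_eq_integral_Ioc,
    intervalIntegral.integral_of_le hab]

theorem ContDiffOn.continuousOn_derivWithin_Icc {a b : ℝ} (hab : a < b) {f : ℝ → ℝ}
    (hf : ContDiffOn ℝ 1 f (Icc a b)) : ContinuousOn (derivWithin f (Icc a b)) (Icc a b) :=
  hf.continuousOn_derivWithin (uniqueDiffOn_Icc hab) le_rfl

theorem ContDiffOn.hasDerivWithinAt_Icc {a b : ℝ} {f : ℝ → ℝ}
    (hf : ContDiffOn ℝ 1 f (Icc a b)) {x : ℝ} (hx : x ∈ Icc a b) :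
    HasDerivWithinAt f (derivWithin f (Icc a b) x) (Icc a b) x :=
  (hf.differentiableOn one_ne_zero x hx).hasDerivWithinAt

theorem ContDiffOn.integral_derivWithin_Icc {a b : ℝ} (hab : a < b) {f : ℝ → ℝ}
    (hf : ContDiffOn ℝ 1 f (Icc a b)) {y : ℝ} (hy : y ∈ Icc a b) :
    ∫ x in a..y, derivWithin f (Icc a b) x = f y - f a := by
  have hsub : Icc a y ⊆ Icc a b := Icc_subset_Icc_right hy.2
  refine intervalIntegral.integral_eq_sub_of_hasDerivAt_of_le hy.1 (hf.continuousOn.mono hsub)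
    (fun x hx => ?_) ?_
  · have hx' : x ∈ Ioo a b := ⟨hx.1, hx.2.trans_le hy.2⟩
    exact (hf.hasDerivWithinAt_Icc (Ioo_subset_Icc_self hx')).hasDerivAt (Icc_mem_nhds hx'.1 hx'.2)
  · refine ContinuousOn.intervalIntegrable ?_
    rw [uIcc_of_le hy.1]
    exact (hf.continuousOn_derivWithin_Icc hab).mono hsub

theorem ContinuousOn.integrable_subtype_Icc {a b : ℝ} {f : ℝ → ℝ} (hf : ContinuousOn f (Icc a b))
    (μ : Measure (Icc a b)) [IsFiniteMeasure μ] : Integrable (fun x : Icc a b => f x) μ := by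
  have hc : Continuous fun x : Icc a b => f x := hf.domRestrict
  exact integrableOn_univ.1 (hc.continuousOn.integrableOn_compact isCompact_univ)

/-- The mass of `σ` to the right of `x`, as a function of `x`. -/
noncomputable def upperMass {a b : ℝ} (σ : Measure (Icc a b)) (x : Icc a b) : ℝ := σ.real (Ici x)

theorem antitone_upperMass {a b : ℝ} (σ : Measure (Icc a b)) [IsFiniteMeasure σ] :
    Antitone (upperMass σ) := fun _ _ h => measureReal_mono (Ici_subset_Ici.2 h)

theorem measurable_upperMass {a b : ℝ} (σ : Measure (Icc a b)) [IsFiniteMeasure σ] :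
    Measurable (upperMass σ) := (antitone_upperMass σ).measurable

theorem abs_upperMass_le {a b : ℝ} (σ : Measure (Icc a b)) [IsFiniteMeasure σ] (x : Icc a b) :
    |upperMass σ x| ≤ σ.real univ := by
  rw [upperMass, abs_of_nonneg measureReal_nonneg]
  exact measureReal_mono (subset_univ _)

/-- Layer-cake form of integration of a `C^1` function against a finite measure on an interval. -/
theorem ContDiffOn.integral_eq_upperMass {a b : ℝ} (hab : a < b) {f : ℝ → ℝ}
    (hf : ContDiffOn ℝ 1 f (Icc a b)) (σ : Measure (Icc a b)) [IsFiniteMeasure σ] :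
    ∫ x, f x ∂σ = f a * σ.real univ +
      ∫ x : Icc a b, derivWithin f (Icc a b) x * upperMass σ x := by
  set f' : Icc a b → ℝ := fun x => derivWithin f (Icc a b) x with hf'
  have hcont : Continuous f' := (hf.continuousOn_derivWithin_Icc hab).domRestrict
  have hset : MeasurableSet {p : Icc a b × Icc a b | p.2 ≤ p.1} :=
    measurableSet_le measurable_snd measurable_fst
  have hf'i : Integrable f' (volume : Measure (Icc a b)) :=
    (hf.continuousOn_derivWithin_Icc hab).integrable_subtype_Icc _
  have hint : Integrable (Function.uncurry fun y x : Icc a b => (Iic y).indicator f' x)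
      (σ.prod volume) := by
    have h1 : Integrable (fun p : Icc a b × Icc a b => f' p.2) (σ.prod volume) :=
      hf'i.comp_snd σ
    exact (h1.indicator hset)
  have hin : ∀ y : Icc a b, f y = f a + ∫ x : Icc a b, (Iic y).indicator f' x := by
    intro y
    have h1 : ∫ x : Icc a b, (Iic y).indicator f' x =
        ∫ x in a..b, (Iic (y : ℝ)).indicator (derivWithin f (Icc a b)) x := by
      rw [← integral_Icc_subtype_eq_intervalIntegral hab.le]
      rfl
    have h2 : ∫ x in a..b, (Iic (y : ℝ)).indicator (derivWithin f (Icc a b)) x =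
        ∫ x in a..y, derivWithin f (Icc a b) x :=
      intervalIntegral.integral_indicator (Icc_subset_Icc_right le_rfl y.2)
    rw [h1, h2, hf.integral_derivWithin_Icc hab y.2]
    ring
  have hi2 : Integrable (fun y => ∫ x : Icc a b, (Iic y).indicator f' x) σ :=
    hint.integral_prod_left
  calc ∫ x, f x ∂σ = ∫ y : Icc a b, (f a + ∫ x : Icc a b, (Iic y).indicator f' x) ∂σ :=
        integral_congr_ae (Filter.Eventually.of_forall hin)
    _ = f a * σ.real univ + ∫ y : Icc a b, ∫ x : Icc a b, (Iic y).indicator f' x ∂volume ∂σ := by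
        rw [integral_add (integrable_const _) hi2]
        simp [mul_comm]
    _ = f a * σ.real univ + ∫ x : Icc a b, ∫ y : Icc a b, (Iic y).indicator f' x ∂σ := by
        rw [integral_integral_swap hint]
    _ = _ := by
        congr 2
        funext x
        have : (fun y : Icc a b => (Iic y).indicator f' x) = (Ici x).indicator fun _ => f' x := by
          funext y
          by_cases h : x ≤ y <;> simp [h]
        rw [this, integral_indicator measurableSet_Ici]
        simp [upperMass, mul_comm, hf']

/-! ### Sweeping a state to one vertex by a bounded flux -/

namespace Network

variable {n m : ℕ} (G : Network n m)

theorem edgePt_startPt (j : Fin m) : G.edgePt j (G.startPt j) = G.vertexPt (G.src j) :=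
  Quot.sound (Glue.start j)

theorem edgePt_endPt (j : Fin m) : G.edgePt j (G.endPt j) = G.vertexPt (G.tgt j) :=
  Quot.sound (Glue.finish j)

/-- The coordinate expression on the edge `E^j` of a function on the network. -/
noncomputable def edgeCoord (φ : G.Space → ℝ) (j : Fin m) (x : ℝ) : ℝ :=
  φ (G.edgePt j (projIcc 0 (G.length j) (G.length_pos j).le x))

variable {G}

theorem edgeCoord_coe (φ : G.Space → ℝ) (j : Fin m) (x : G.ClosedEdge j) :
    G.edgeCoord φ j x = φ (G.edgePt j x) := by
  rw [edgeCoord, projIcc_val]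

theorem edgeCoord_zero (φ : G.Space → ℝ) (j : Fin m) :
    G.edgeCoord φ j 0 = φ (G.vertexPt (G.src j)) := by
  rw [← edgePt_startPt]
  exact edgeCoord_coe φ j (G.startPt j)

theorem edgeCoord_length (φ : G.Space → ℝ) (j : Fin m) :
    G.edgeCoord φ j (G.length j) = φ (G.vertexPt (G.tgt j)) := by
  rw [← edgePt_endPt]
  exact edgeCoord_coe φ j (G.endPt j)

/-- On a connected network, every unit mass distribution is the sum of a point mass at a vertex
and the divergence of a bounded flux. -/
theorem Connected.exists_flux (hG : G.Connected) (i₀ : Fin n)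
    (σ : ∀ j, Measure (G.ClosedEdge j)) [∀ j, IsFiniteMeasure (σ j)] (γ : Fin n → ℝ)
    (hmass : ∑ j, (σ j).real univ + ∑ i, γ i = 1) :
    ∃ H : ∀ j, G.ClosedEdge j → ℝ, (∀ j, Measurable (H j)) ∧ (∃ C, ∀ j x, |H j x| ≤ C) ∧
      ∀ φ : G.Space → ℝ, (∀ j, ContDiffOn ℝ 1 (G.edgeCoord φ j) (Icc 0 (G.length j))) →
        ∑ j, ∫ x : G.ClosedEdge j,
          derivWithin (G.edgeCoord φ j) (Icc 0 (G.length j)) x * H j x =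
        ∑ j, ∫ x, φ (G.edgePt j x) ∂(σ j) + ∑ i, φ (G.vertexPt i) * γ i -
          φ (G.vertexPt i₀) := by
  choose c hc using fun i => hG.exists_weights i₀ i
  -- `upperMass` moves the mass of each edge `k` to its initial vertex. The constants `e j` then
  -- superpose the path weights from `i₀`, for these collected masses and for the masses `γ i`.
  set e : Fin m → ℝ := fun j => ∑ k, (σ k).real univ * c (G.src k) j + ∑ i, γ i * c i j with he
  refine ⟨fun j x => upperMass (σ j) x + e j,
    fun j => (measurable_upperMass _).add_const _, ⟨∑ j, ((σ j).real univ + |e j|), ?_⟩, ?_⟩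
  · intro j x
    calc |upperMass (σ j) x + e j| ≤ (σ j).real univ + |e j| :=
          (abs_add_le _ _).trans (add_le_add_left (abs_upperMass_le _ _) _)
      _ ≤ _ := Finset.single_le_sum (f := fun j => (σ j).real univ + |e j|)
          (fun j _ => by positivity) (Finset.mem_univ j)
  · intro φ hφ
    set u : Fin n → ℝ := fun i => φ (G.vertexPt i) with hu
    have hedge : ∀ j, ∫ x : G.ClosedEdge j,
        derivWithin (G.edgeCoord φ j) (Icc 0 (G.length j)) x * (upperMass (σ j) x + e j) =
        ∫ x, φ (G.edgePt j x) ∂(σ j) - u (G.src j) * (σ j).real univ +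
          e j * (u (G.tgt j) - u (G.src j)) := by
      intro j
      have hL := G.length_pos j
      have h1 := (hφ j).integral_eq_upperMass hL (σ j)
      have h2 : ∫ x : G.ClosedEdge j, derivWithin (G.edgeCoord φ j) (Icc 0 (G.length j)) x =
          u (G.tgt j) - u (G.src j) := by
        rw [integral_Icc_subtype_eq_intervalIntegral hL.le
          (derivWithin (G.edgeCoord φ j) (Icc 0 (G.length j))),
          (hφ j).integral_derivWithin_Icc hL ⟨hL.le, le_rfl⟩, edgeCoord_zero, edgeCoord_length]
      simp only [edgeCoord_coe, edgeCoord_zero] at h1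
      have hi := ((hφ j).continuousOn_derivWithin_Icc hL).integrable_subtype_Icc volume
      simp only [mul_add]
      rw [integral_add _ (hi.mul_const _), integral_mul_const, h2, h1]
      · ring
      · refine hi.mul_bdd (c := (σ j).real univ) (measurable_upperMass _).aestronglyMeasurable ?_
        exact Filter.Eventually.of_forall (abs_upperMass_le _)
    simp only [hedge, Finset.sum_add_distrib, Finset.sum_sub_distrib]
    have hpot : ∑ j, e j * (u (G.tgt j) - u (G.src j)) =
        ∑ k, (σ k).real univ * (u (G.src k) - u i₀) + ∑ i, γ i * (u i - u i₀) := by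
      simp only [hc _ u, he, add_mul, Finset.sum_add_distrib, Finset.sum_mul, Finset.mul_sum]
      rw [Finset.sum_comm, Finset.sum_comm (f := fun j i => γ i * c i j * _)]
      simp only [mul_assoc]
    rw [hpot]
    simp only [mul_sub, Finset.sum_sub_distrib, ← Finset.sum_mul]
    -- This is where total mass one enters: exactly a unit mass arrives at `i₀`.
    have h3 : u i₀ = (∑ j, (σ j).real univ) * u i₀ + (∑ i, γ i) * u i₀ := by
      rw [← add_mul, hmass, one_mul]
    have h4 : ∑ j, u (G.src j) * (σ j).real univ = ∑ j, (σ j).real univ * u (G.src j) :=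
      Finset.sum_congr rfl fun _ _ => mul_comm _ _
    have h5 : ∑ i, u i * γ i = ∑ i, γ i * u i := Finset.sum_congr rfl fun _ _ => mul_comm _ _
    rw [h4, h5]
    linarith

theorem measurable_edgePt (j : Fin m) : Measurable (G.edgePt j) :=
  measurable_quot_mk.comp (measurable_inr.comp (Measurable.of_le_map (iInf_le _ j)))

/-- The total mass on the network is the sum of the masses of the edges and vertices. -/
theorem sum_mass_eq_one (ρ : ∀ j, FiniteMeasure (G.ClosedEdge j)) (γ : Fin n → ℝ≥0)
    (h : IsProbabilityMeasure (G.totalDensity ρ γ)) :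
    ∑ j, (ρ j : Measure (G.ClosedEdge j)).real univ + ∑ i, (γ i : ℝ) = 1 := by
  have h1 := h.measure_univ
  simp only [totalDensity, Measure.add_apply, Measure.finsetSum_apply,
    Measure.map_apply (measurable_edgePt _) MeasurableSet.univ, preimage_univ,
    Measure.smul_apply, measure_univ] at h1
  have h2 := congrArg ENNReal.toReal h1
  rw [ENNReal.toReal_add, ENNReal.toReal_sum, ENNReal.toReal_sum] at h2
  · simpa [Measure.real, ENNReal.smul_def] using h2
  · simp [ENNReal.smul_def]
  · simp
  · simp [ENNReal.sum_eq_top]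
  · simp [ENNReal.sum_eq_top, ENNReal.smul_def]

end Network

/-! ### Interpolation weights in time -/

/-- Weights on `[0,1]`, with continuous derivatives that sum to zero, by which finitely many states
are interpolated. -/
structure Interpolation (ι : Type*) [Fintype ι] where
  weight : ι → ℝ → ℝ
  rate : ι → ℝ → ℝ
  hasDerivAt : ∀ k t, HasDerivAt (weight k) (rate k t) t
  continuous_rate : ∀ k, Continuous (rate k)
  weight_nonneg : ∀ k, ∀ t ∈ Icc (0 : ℝ) 1, 0 ≤ weight k t
  sum_rate : ∀ t, ∑ k, rate k t = 0

namespace Interpolation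

variable {ι : Type*} [Fintype ι] (I : Interpolation ι)

theorem continuous_weight (k : ι) : Continuous (I.weight k) :=
  continuous_iff_continuousAt.2 fun t => (I.hasDerivAt k t).continuousAt

/-- The measure on `[0,1]` with density the `k`-th weight. -/
noncomputable def timeMeasure (k : ι) : Measure (Icc (0 : ℝ) 1) :=
  volume.withDensity fun t => ENNReal.ofReal (I.weight k t)

instance (k : ι) : IsFiniteMeasure (I.timeMeasure k) :=
  have h : Integrable (fun t : Icc (0 : ℝ) 1 => I.weight k t) volume :=
    (I.continuous_weight k).continuousOn.integrable_subtype_Icc _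
  isFiniteMeasure_withDensity_ofReal h.2

theorem integral_timeMeasure (k : ι) (f : Icc (0 : ℝ) 1 → ℝ) :
    ∫ t, f t ∂(I.timeMeasure k) = ∫ t : Icc (0 : ℝ) 1, I.weight k t * f t := by
  have hm : Measurable fun t : Icc (0 : ℝ) 1 => ENNReal.ofReal (I.weight k t) :=
    ((I.continuous_weight k).measurable.comp measurable_subtype_coe).ennreal_ofReal
  rw [timeMeasure, integral_withDensity_eq_integral_toReal_smul hm (by simp)]
  congr 1
  funext t
  rw [ENNReal.toReal_ofReal (I.weight_nonneg k t t.2), smul_eq_mul]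

theorem integral_weight_mul_derivWithin (k : ι) {u : ℝ → ℝ} (hu : ContDiffOn ℝ 1 u (Icc 0 1)) :
    ∫ t : Icc (0 : ℝ) 1, I.weight k t * derivWithin u (Icc 0 1) t =
      I.weight k 1 * u 1 - I.weight k 0 * u 0 - ∫ t : Icc (0 : ℝ) 1, I.rate k t * u t := by
  rw [integral_Icc_subtype_eq_intervalIntegral zero_le_one
      fun t => I.weight k t * derivWithin u (Icc 0 1) t,
    integral_Icc_subtype_eq_intervalIntegral zero_le_one fun t => I.rate k t * u t]
  refine intervalIntegral.integral_mul_deriv_eq_deriv_mul_of_hasDerivWithinAt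
    (fun t _ => (I.hasDerivAt k t).hasDerivWithinAt) ?_ ((I.continuous_rate k).intervalIntegrable ..)
    ?_
  · rw [uIcc_of_le zero_le_one]
    exact fun t ht => hu.hasDerivWithinAt_Icc ht
  · refine ContinuousOn.intervalIntegrable ?_
    rw [uIcc_of_le zero_le_one]
    exact hu.continuousOn_derivWithin_Icc zero_lt_one

end Interpolation

/-- The weights `(1 - s)²`, `s²`, `2 s (1 - s)` with `s = 3 t² - 2 t³`. -/
noncomputable def smoothInterpolation : Interpolation (Fin 3) where
  weight k t := ![(1 - (3 * t ^ 2 - 2 * t ^ 3)) ^ 2, (3 * t ^ 2 - 2 * t ^ 3) ^ 2,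
    2 * (3 * t ^ 2 - 2 * t ^ 3) * (1 - (3 * t ^ 2 - 2 * t ^ 3))] k
  rate k t := ![-2 * (1 - (3 * t ^ 2 - 2 * t ^ 3)) * (6 * t * (1 - t)),
    2 * (3 * t ^ 2 - 2 * t ^ 3) * (6 * t * (1 - t)),
    2 * (1 - 2 * (3 * t ^ 2 - 2 * t ^ 3)) * (6 * t * (1 - t))] k
  hasDerivAt k t := by
    have hs : HasDerivAt (fun t : ℝ => 3 * t ^ 2 - 2 * t ^ 3) (6 * t * (1 - t)) t := by
      have := ((hasDerivAt_pow 2 t).const_mul 3).sub ((hasDerivAt_pow 3 t).const_mul 2)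
      refine this.congr_deriv ?_
      norm_num
      ring
    fin_cases k
    · refine ((hs.const_sub 1).pow 2).congr_deriv ?_
      simp
    · refine (hs.pow 2).congr_deriv ?_
      simp
    · refine ((hs.const_mul 2).mul (hs.const_sub 1)).congr_deriv ?_
      simp
      ring
  continuous_rate k := by
    fin_cases k <;> simp <;> fun_prop
  weight_nonneg k t ht := by
    have h0 : 0 ≤ 3 * t ^ 2 - 2 * t ^ 3 := by nlinarith [ht.1, ht.2, sq_nonneg t]
    have h1 : 0 ≤ 1 - (3 * t ^ 2 - 2 * t ^ 3) := by nlinarith [ht.1, ht.2, sq_nonneg (1 - t)]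
    fin_cases k <;> simp <;> positivity
  sum_rate t := by
    simp [Fin.sum_univ_three]
    ring

/-- Each rate is, up to sign, `2 a s'` with `|a| ≤ 1` and `s' = 6 t (1 - t)`, so its square is at
most `144 t² (1 - t)²`. As `s ≥ t²` and `1 - s ≥ (1 - t)²`, this is at most `144 s (1 - s)`, that
is, `72` times the third weight. -/
theorem smoothInterpolation_rate_sq_le {t : ℝ} (ht : t ∈ Ioo (0 : ℝ) 1) (k : Fin 3) :
    smoothInterpolation.rate k t ^ 2 ≤ 72 * smoothInterpolation.weight 2 t := by
  have h0 : t ^ 2 ≤ 3 * t ^ 2 - 2 * t ^ 3 := by nlinarith [ht.1, ht.2, sq_nonneg t]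
  have h1 : (1 - t) ^ 2 ≤ 1 - (3 * t ^ 2 - 2 * t ^ 3) := by
    nlinarith [ht.1, ht.2, sq_nonneg (1 - t)]
  have h2 : t ^ 2 * (1 - t) ^ 2 ≤
      (3 * t ^ 2 - 2 * t ^ 3) * (1 - (3 * t ^ 2 - 2 * t ^ 3)) :=
    mul_le_mul h0 h1 (sq_nonneg _) ((sq_nonneg t).trans h0)
  have key : ∀ a : ℝ, |a| ≤ 1 → (2 * a * (6 * t * (1 - t))) ^ 2 ≤
      72 * (2 * (3 * t ^ 2 - 2 * t ^ 3) * (1 - (3 * t ^ 2 - 2 * t ^ 3))) := by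
    intro a ha
    have ha2 : a ^ 2 ≤ 1 := (sq_le_one_iff_abs_le_one a).2 ha
    calc (2 * a * (6 * t * (1 - t))) ^ 2 = a ^ 2 * (144 * (t ^ 2 * (1 - t) ^ 2)) := by ring
      _ ≤ 1 * (144 * (t ^ 2 * (1 - t) ^ 2)) := by gcongr
      _ ≤ _ := by linarith
  set s := 3 * t ^ 2 - 2 * t ^ 3 with hs
  have hs0 : 0 ≤ s := (sq_nonneg t).trans h0
  have hs1 : 0 ≤ 1 - s := (sq_nonneg (1 - t)).trans h1
  fin_cases k
  · simpa [smoothInterpolation, ← hs] using key (1 - s) (abs_le.2 ⟨by linarith, by linarith⟩)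
  · simpa [smoothInterpolation, ← hs] using key s (abs_le.2 ⟨by linarith, by linarith⟩)
  · simpa [smoothInterpolation, ← hs] using key (1 - 2 * s) (abs_le.2 ⟨by linarith, by linarith⟩)

theorem smoothInterpolation_sum_weight_zero (a : Fin 3 → ℝ) :
    ∑ k, smoothInterpolation.weight k 0 * a k = a 0 := by
  have h0 : smoothInterpolation.weight 0 0 = 1 := by norm_num [smoothInterpolation]
  have h1 : smoothInterpolation.weight 1 0 = 0 := by norm_num [smoothInterpolation]
  have h2 : smoothInterpolation.weight 2 0 = 0 := by simp [smoothInterpolation]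
  rw [Fin.sum_univ_three, h0, h1, h2]
  ring

theorem smoothInterpolation_sum_weight_one (a : Fin 3 → ℝ) :
    ∑ k, smoothInterpolation.weight k 1 * a k = a 1 := by
  have h0 : smoothInterpolation.weight 0 1 = 0 := by norm_num [smoothInterpolation]
  have h1 : smoothInterpolation.weight 1 1 = 1 := by norm_num [smoothInterpolation]
  have h2 : smoothInterpolation.weight 2 1 = 0 := by
    simp only [smoothInterpolation, Matrix.cons_val]
    norm_num
  rw [Fin.sum_univ_three, h0, h1, h2]
  ring

theorem smoothInterpolation_weight_two_pos {t : ℝ} (ht : t ∈ Ioo (0 : ℝ) 1) :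
    0 < smoothInterpolation.weight 2 t := by
  have h0 : 0 < 3 * t ^ 2 - 2 * t ^ 3 := by nlinarith [ht.1, ht.2, pow_pos ht.1 2]
  have h1 : 0 < 1 - (3 * t ^ 2 - 2 * t ^ 3) := by
    nlinarith [ht.1, ht.2, pow_pos (sub_pos.2 ht.2) 2]
  simp only [smoothInterpolation, Matrix.cons_val]
  positivity

/-! ### Regularity of test functions -/

namespace Network

variable {n m : ℕ} {G : Network n m}

theorem IsTestFunction.contDiffOn_edgeCoord {φ : ℝ → G.Space → ℝ} (hφ : G.IsTestFunction φ)
    (j : Fin m) {t : ℝ} (ht : t ∈ Icc (0 : ℝ) 1) :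
    ContDiffOn ℝ 1 (G.edgeCoord (φ t) j) (Icc 0 (G.length j)) :=
  (hφ.1 j).comp (f := fun x : ℝ => (t, x)) (by fun_prop) fun _ hx => ⟨ht, hx⟩

theorem IsTestFunction.contDiffOn_time {φ : ℝ → G.Space → ℝ} (hφ : G.IsTestFunction φ)
    (j : Fin m) {x : ℝ} (hx : x ∈ Icc 0 (G.length j)) :
    ContDiffOn ℝ 1 (fun t => G.onEdge φ j t x) (Icc 0 1) :=
  (hφ.1 j).comp (f := fun t : ℝ => (t, x)) (by fun_prop) fun _ ht => ⟨ht, hx⟩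

theorem IsTestFunction.continuous_edge {φ : ℝ → G.Space → ℝ} (hφ : G.IsTestFunction φ)
    (j : Fin m) :
    Continuous fun z : G.EdgeSpaceTime j => φ z.1 (G.edgePt j z.2) := by
  have h : Continuous fun z : G.EdgeSpaceTime j => G.onEdge φ j z.1 z.2 :=
    (hφ.1 j).continuousOn.comp_continuous (f := fun z : G.EdgeSpaceTime j => ((z.1 : ℝ), (z.2 : ℝ)))
      (by fun_prop) fun z => ⟨z.1.2, z.2.2⟩
  simpa only [onEdge, projIcc_val] using h

theorem IsTestFunction.continuous_fderivWithin {φ : ℝ → G.Space → ℝ} (hφ : G.IsTestFunction φ)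
    (j : Fin m) (v : ℝ × ℝ) :
    Continuous fun z : G.EdgeSpaceTime j =>
      fderivWithin ℝ (fun p : ℝ × ℝ => G.onEdge φ j p.1 p.2) (Icc 0 1 ×ˢ Icc 0 (G.length j))
        ((z.1 : ℝ), (z.2 : ℝ)) v := by
  have hu : UniqueDiffOn ℝ (Icc (0 : ℝ) 1 ×ˢ Icc 0 (G.length j)) :=
    (uniqueDiffOn_Icc zero_lt_one).prod (uniqueDiffOn_Icc (G.length_pos j))
  have h := ((hφ.1 j).continuousOn_fderivWithin hu le_rfl).comp_continuous
    (f := fun z : G.EdgeSpaceTime j => ((z.1 : ℝ), (z.2 : ℝ))) (by fun_prop)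
    fun z => mk_mem_prod z.1.2 z.2.2
  exact h.clm_apply continuous_const

/-- The one-sided partial derivative is the joint derivative within the rectangle applied to `(1,
0)`, and the latter is continuous up to the boundary. -/
theorem IsTestFunction.continuous_timeDeriv {φ : ℝ → G.Space → ℝ} (hφ : G.IsTestFunction φ)
    (j : Fin m) : Continuous (G.timeDeriv φ j) := by
  convert hφ.continuous_fderivWithin j (1, 0) using 2 with z
  have hd := ((hφ.1 j).differentiableOn one_ne_zero (z.1, z.2) (mk_mem_prod z.1.2 z.2.2)).hasFDerivWithinAt
  have hc : HasDerivWithinAt (fun t : ℝ => (t, (z.2 : ℝ))) (1, 0) (Icc 0 1) z.1 :=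
    (hasDerivWithinAt_id _ _).prodMk (hasDerivWithinAt_const _ _ _)
  exact (hd.comp_hasDerivWithinAt (z.1 : ℝ) hc fun t ht => mk_mem_prod ht z.2.2).derivWithin
    (uniqueDiffOn_Icc zero_lt_one _ z.1.2)

theorem IsTestFunction.continuous_spaceDeriv {φ : ℝ → G.Space → ℝ} (hφ : G.IsTestFunction φ)
    (j : Fin m) : Continuous (G.spaceDeriv φ j) := by
  convert hφ.continuous_fderivWithin j (0, 1) using 2 with z
  have hd := ((hφ.1 j).differentiableOn one_ne_zero (z.1, z.2) (mk_mem_prod z.1.2 z.2.2)).hasFDerivWithinAt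
  have hc : HasDerivWithinAt (fun x : ℝ => ((z.1 : ℝ), x)) (0, 1) (Icc 0 (G.length j)) z.2 :=
    (hasDerivWithinAt_const _ _ _).prodMk (hasDerivWithinAt_id _ _)
  exact (hd.comp_hasDerivWithinAt (z.2 : ℝ) hc fun t ht => mk_mem_prod z.1.2 ht).derivWithin
    (uniqueDiffOn_Icc (G.length_pos j) _ z.2.2)

end Network

theorem Continuous.integrable_of_compactSpace {X : Type*} [TopologicalSpace X] [CompactSpace X]
    [MeasurableSpace X] [OpensMeasurableSpace X] [T2Space X] {f : X → ℝ} (hf : Continuous f)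
    (μ : Measure X) [IsFiniteMeasure μ] : Integrable f μ :=
  integrableOn_univ.1 (hf.continuousOn.integrableOn_compact isCompact_univ)

namespace Interpolation

variable {ι : Type*} [Fintype ι] (I : Interpolation ι)

theorem continuous_rate_coe (k : ι) : Continuous fun t : Icc (0 : ℝ) 1 => I.rate k t :=
  (I.continuous_rate k).comp continuous_subtype_val

/-- A combination of the rates is controlled by any weight that controls their squares. -/
theorem sum_rate_mul_sq_le {k₀ : ι} {K C t : ℝ}
    (hK : ∀ k, I.rate k t ^ 2 ≤ K * I.weight k₀ t) {h : ι → ℝ} (hC : ∀ k, |h k| ≤ C) :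
    (∑ k, I.rate k t * h k) ^ 2 ≤
      (Fintype.card ι : ℝ) ^ 2 * C ^ 2 * K * I.weight k₀ t := by
  have h1 : ∀ k ∈ Finset.univ, (I.rate k t * h k) ^ 2 ≤ C ^ 2 * K * I.weight k₀ t := by
    intro k _
    have h2 : h k ^ 2 ≤ C ^ 2 := by
      rw [← sq_abs]
      exact pow_le_pow_left₀ (abs_nonneg _) (hC k) 2
    calc (I.rate k t * h k) ^ 2 = h k ^ 2 * I.rate k t ^ 2 := by ring
      _ ≤ C ^ 2 * (K * I.weight k₀ t) :=
        mul_le_mul h2 (hK k) (sq_nonneg _) (sq_nonneg _)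
      _ = _ := by ring
  calc (∑ k, I.rate k t * h k) ^ 2
      ≤ Fintype.card ι * ∑ k, (I.rate k t * h k) ^ 2 := sq_sum_le_card_mul_sum_sq
    _ ≤ Fintype.card ι * ∑ _k : ι, C ^ 2 * K * I.weight k₀ t := by
        gcongr with k hk
        exact h1 k hk
    _ = _ := by
        rw [Finset.sum_const, Finset.card_univ, nsmul_eq_mul]
        ring

end Interpolation

/-! ### The interpolating curve and its continuity equation -/

namespace Network

variable {n m : ℕ} {G : Network n m} {ι : Type*} [Fintype ι] (I : Interpolation ι)

/-- The interpolation of mass distributions on a closed edge, as a measure on space-time. -/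
noncomputable def edgeMass {j : Fin m} (σ : ι → Measure (G.ClosedEdge j)) :
    Measure (G.EdgeSpaceTime j) :=
  ∑ k, (I.timeMeasure k).prod (σ k)

instance {j : Fin m} (σ : ι → Measure (G.ClosedEdge j)) [∀ k, IsFiniteMeasure (σ k)] :
    IsFiniteMeasure (edgeMass I σ) := by
  unfold edgeMass
  infer_instance

/-- The density of the flux that accompanies an interpolation of mass distributions. -/
noncomputable def edgeFlux {j : Fin m} (H : ι → G.ClosedEdge j → ℝ) (z : G.EdgeSpaceTime j) : ℝ :=
  ∑ k, I.rate k z.1 * H k z.2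

theorem measurable_edgeFlux {j : Fin m} {H : ι → G.ClosedEdge j → ℝ} (hH : ∀ k, Measurable (H k)) :
    Measurable (edgeFlux I H) :=
  Finset.measurable_sum _ fun k _ =>
    ((I.continuous_rate_coe k).measurable.comp measurable_fst).mul ((hH k).comp measurable_snd)

theorem integrable_mul_rate_mul {j : Fin m} {ψ : G.EdgeSpaceTime j → ℝ} (hψ : Continuous ψ)
    {h : G.ClosedEdge j → ℝ} (hm : Measurable h) {C : ℝ} (hC : ∀ x, |h x| ≤ C) (k : ι)
    (σ : Measure (G.ClosedEdge j)) [IsFiniteMeasure σ] :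
    Integrable (fun z : G.EdgeSpaceTime j => I.rate k z.1 * (ψ z * h z.2))
      ((volume : Measure (Icc (0 : ℝ) 1)).prod σ) := by
  have h1 : Integrable (fun z : G.EdgeSpaceTime j => I.rate k z.1 * ψ z)
      ((volume : Measure (Icc (0 : ℝ) 1)).prod σ) :=
    (((I.continuous_rate_coe k).comp continuous_fst).mul hψ).integrable_of_compactSpace _
  simp only [← mul_assoc]
  exact h1.mul_bdd (c := C) (hm.comp measurable_snd).aestronglyMeasurable
    (Filter.Eventually.of_forall fun z => hC z.2)

theorem integrable_edgeFlux {j : Fin m} {H : ι → G.ClosedEdge j → ℝ} (hH : ∀ k, Measurable (H k))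
    {C : ℝ} (hC : ∀ k x, |H k x| ≤ C) :
    Integrable (edgeFlux I H) ((volume : Measure (Icc (0 : ℝ) 1)).prod volume) := by
  refine integrable_finsetSum _ fun k _ => ?_
  simpa using integrable_mul_rate_mul I (G := G) (j := j) (ψ := fun _ => 1) continuous_const
    (hH k) (hC k) k volume

/-- The curve that interpolates mass distributions with accompanying fluxes. -/
noncomputable def interpolationCurve (σ : ι → ∀ j, Measure (G.ClosedEdge j))
    [∀ k j, IsFiniteMeasure (σ k j)] (H : ι → ∀ j, G.ClosedEdge j → ℝ) (γ : ι → Fin n → ℝ) :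
    G.Curve where
  ρ j := (edgeMass I fun k => σ k j).toSignedMeasure
  F j := ((volume : Measure (Icc (0 : ℝ) 1)).prod volume).withDensityᵥ (edgeFlux I fun k => H k j)
  γ i t := ∑ k, I.weight k t * γ k i
  f i t := ∑ k, I.rate k t * γ k i
  γ_integrable _ := (continuous_finsetSum _ fun k _ =>
    (I.continuous_weight k).mul_const _).continuousOn.integrableOn_Icc
  f_integrable _ := (continuous_finsetSum _ fun k _ =>
    (I.continuous_rate k).mul_const _).continuousOn.integrableOn_Icc

/-- Fubini and integration by parts in time at each fixed point of the edge. The measures `σ k` need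
no regularity in space, as only the weights are differentiated. -/
theorem integral_timeDeriv_edgeMass {φ : ℝ → G.Space → ℝ} (hφ : G.IsTestFunction φ) (j : Fin m)
    (σ : ι → Measure (G.ClosedEdge j)) [∀ k, IsFiniteMeasure (σ k)] :
    ∫ z, G.timeDeriv φ j z ∂(edgeMass I σ) =
      ∑ k, (I.weight k 1 * ∫ x, φ 1 (G.edgePt j x) ∂(σ k) -
        I.weight k 0 * ∫ x, φ 0 (G.edgePt j x) ∂(σ k) -
        ∫ t : Icc (0 : ℝ) 1, I.rate k t * ∫ x, φ t (G.edgePt j x) ∂(σ k)) := by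
  have hcont := hφ.continuous_timeDeriv j
  rw [edgeMass, integral_finsetSum_measure fun k _ => hcont.integrable_of_compactSpace _]
  refine Finset.sum_congr rfl fun k _ => ?_
  have hslice : ∀ t : Icc (0 : ℝ) 1, Continuous fun x : G.ClosedEdge j => φ t (G.edgePt j x) :=
    fun t => (hφ.continuous_edge j).comp (Continuous.prodMk_right t)
  have hint : Integrable (fun z : G.EdgeSpaceTime j => I.rate k z.1 * φ z.1 (G.edgePt j z.2))
      ((volume : Measure (Icc (0 : ℝ) 1)).prod (σ k)) :=
    (((I.continuous_rate_coe k).comp continuous_fst).mul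
      (hφ.continuous_edge j)).integrable_of_compactSpace _
  have h1 : Integrable (fun x => φ 1 (G.edgePt j x)) (σ k) :=
    (hslice ⟨1, zero_le_one, le_rfl⟩).integrable_of_compactSpace _
  have h0 : Integrable (fun x => φ 0 (G.edgePt j x)) (σ k) :=
    (hslice ⟨0, le_rfl, zero_le_one⟩).integrable_of_compactSpace _
  rw [integral_prod_symm _ (hcont.integrable_of_compactSpace _)]
  have hx : ∀ x : G.ClosedEdge j, ∫ t, G.timeDeriv φ j (t, x) ∂(I.timeMeasure k) =
      I.weight k 1 * φ 1 (G.edgePt j x) - I.weight k 0 * φ 0 (G.edgePt j x) -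
        ∫ t : Icc (0 : ℝ) 1, I.rate k t * φ t (G.edgePt j x) := by
    intro x
    rw [I.integral_timeMeasure]
    refine (I.integral_weight_mul_derivWithin k (hφ.contDiffOn_time j x.2)).trans ?_
    simp only [onEdge, projIcc_val]
  simp only [hx]
  have h10 : Integrable (fun x => I.weight k 1 * φ 1 (G.edgePt j x) -
      I.weight k 0 * φ 0 (G.edgePt j x)) (σ k) := (h1.const_mul _).sub (h0.const_mul _)
  rw [integral_sub h10 hint.integral_prod_right,
    integral_sub (h1.const_mul _) (h0.const_mul _), integral_const_mul, integral_const_mul]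
  congr 1
  rw [← integral_prod_symm _ hint, integral_prod _ hint]
  simp only [integral_const_mul]

theorem integral_spaceDeriv_edgeFlux {φ : ℝ → G.Space → ℝ} (hφ : G.IsTestFunction φ) (j : Fin m)
    {H : ι → G.ClosedEdge j → ℝ} (hH : ∀ k, Measurable (H k)) {C : ℝ} (hC : ∀ k x, |H k x| ≤ C) :
    VectorMeasure.integral
        (((volume : Measure (Icc (0 : ℝ) 1)).prod volume).withDensityᵥ (edgeFlux I H))
        (G.spaceDeriv φ j) (ContinuousLinearMap.lsmul ℝ ℝ).flip =
      ∑ k, ∫ t : Icc (0 : ℝ) 1, I.rate k t * ∫ x : G.ClosedEdge j,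
        derivWithin (G.edgeCoord (φ t) j) (Icc 0 (G.length j)) x * H k x := by
  have hint : ∀ k, Integrable
      (fun z : G.EdgeSpaceTime j => I.rate k z.1 * (G.spaceDeriv φ j z * H k z.2))
      ((volume : Measure (Icc (0 : ℝ) 1)).prod volume) := fun k =>
    integrable_mul_rate_mul I (hφ.continuous_spaceDeriv j) (hH k) (hC k) k volume
  have hsum : (fun z : G.EdgeSpaceTime j => G.spaceDeriv φ j z * edgeFlux I H z) =
      fun z => ∑ k, I.rate k z.1 * (G.spaceDeriv φ j z * H k z.2) := by
    funext z
    rw [edgeFlux, Finset.mul_sum]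
    exact Finset.sum_congr rfl fun k _ => by ring
  rw [Measure.integral_withDensityᵥ _ (measurable_edgeFlux I hH) (integrable_edgeFlux I hH hC), hsum,
    integral_finsetSum _ fun k _ => hint k]
  · refine Finset.sum_congr rfl fun k _ => ?_
    rw [integral_prod _ (hint k)]
    simp only [integral_const_mul]
    rfl
  · rw [hsum]
    exact integrable_finsetSum _ fun k _ => hint k

/-- The continuity equation on the edges for an interpolation of mass distributions. -/
theorem interpolationCurve_edge_equation (σ : ι → ∀ j, Measure (G.ClosedEdge j))
    [∀ k j, IsFiniteMeasure (σ k j)] {H : ι → ∀ j, G.ClosedEdge j → ℝ} {γ : ι → Fin n → ℝ}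
    (hH : ∀ k j, Measurable (H k j)) {C : ℝ} (hC : ∀ k j x, |H k j x| ≤ C) (i₀ : Fin n)
    (hflux : ∀ k, ∀ φ : G.Space → ℝ,
      (∀ j, ContDiffOn ℝ 1 (G.edgeCoord φ j) (Icc 0 (G.length j))) →
        ∑ j, ∫ x : G.ClosedEdge j,
          derivWithin (G.edgeCoord φ j) (Icc 0 (G.length j)) x * H k j x =
        ∑ j, ∫ x, φ (G.edgePt j x) ∂(σ k j) + ∑ i, φ (G.vertexPt i) * γ k i -
          φ (G.vertexPt i₀))
    {φ : ℝ → G.Space → ℝ} (hφ : G.IsTestFunction φ) :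
    ∑ j, (VectorMeasure.integral ((interpolationCurve I σ H γ).ρ j) (G.timeDeriv φ j)
            (ContinuousLinearMap.lsmul ℝ ℝ).flip +
          VectorMeasure.integral ((interpolationCurve I σ H γ).F j) (G.spaceDeriv φ j)
            (ContinuousLinearMap.lsmul ℝ ℝ).flip) -
        ∑ i, ∫ t in (0 : ℝ)..1, φ t (G.vertexPt i) * (interpolationCurve I σ H γ).f i t =
      ∑ j, ∑ k, (I.weight k 1 * ∫ x, φ 1 (G.edgePt j x) ∂(σ k j) -
        I.weight k 0 * ∫ x, φ 0 (G.edgePt j x) ∂(σ k j)) := by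
  simp only [interpolationCurve]
  simp only [VectorMeasure.integral_toSignedMeasure, integral_timeDeriv_edgeMass I hφ,
    fun j => integral_spaceDeriv_edgeFlux I hφ j (fun k => hH k j) (fun k => hC k j)]
  have hv : ∀ i, Continuous fun t : Icc (0 : ℝ) 1 => φ t (G.vertexPt i) := fun i =>
    (hφ.2 i).continuousOn.domRestrict
  have hvi : ∀ k i, Integrable (fun t : Icc (0 : ℝ) 1 => I.rate k t * (φ t (G.vertexPt i) * γ k i))
      volume := fun k i =>
    ((I.continuous_rate_coe k).mul ((hv i).mul_const _)).integrable_of_compactSpace _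
  have hei : ∀ k j, Integrable
      (fun t : Icc (0 : ℝ) 1 => I.rate k t * ∫ x, φ t (G.edgePt j x) ∂(σ k j)) volume := by
    intro k j
    have h := (integrable_mul_rate_mul I (hφ.continuous_edge j) (h := fun _ => 1) measurable_const
      (C := 1) (by simp) k (σ k j)).integral_prod_left
    simpa only [integral_const_mul, mul_one] using h
  have hsi : ∀ k j, Integrable (fun t : Icc (0 : ℝ) 1 => I.rate k t * ∫ x : G.ClosedEdge j,
      derivWithin (G.edgeCoord (φ t) j) (Icc 0 (G.length j)) x * H k j x) volume := by
    intro k j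
    have h := (integrable_mul_rate_mul I (hφ.continuous_spaceDeriv j) (hH k j) (hC k j) k
      volume).integral_prod_left
    simp only [integral_const_mul] at h
    exact h
  have hvert : ∀ i, ∫ t in (0 : ℝ)..1, φ t (G.vertexPt i) * ∑ k, I.rate k t * γ k i =
      ∑ k, ∫ t : Icc (0 : ℝ) 1, I.rate k t * (φ t (G.vertexPt i) * γ k i) := by
    intro i
    rw [← integral_Icc_subtype_eq_intervalIntegral zero_le_one
      (fun t => φ t (G.vertexPt i) * ∑ k, I.rate k t * γ k i),
      ← integral_finsetSum _ fun k _ => hvi k i]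
    congr 1
    funext t
    rw [Finset.mul_sum]
    exact Finset.sum_congr rfl fun k _ => by ring
  have hd : ∀ k, Integrable (fun t : Icc (0 : ℝ) 1 => I.rate k t * φ t (G.vertexPt i₀)) volume :=
    fun k => ((I.continuous_rate_coe k).mul (hv i₀)).integrable_of_compactSpace _
  -- The flux identity is applied to the slice `φ t` at each fixed time, multiplied by the rate and
  -- integrated in time.
  have hbal : ∀ k, ∑ j, ∫ t : Icc (0 : ℝ) 1, I.rate k t * ∫ x : G.ClosedEdge j,
        derivWithin (G.edgeCoord (φ t) j) (Icc 0 (G.length j)) x * H k j x =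
      ∑ j, (∫ t : Icc (0 : ℝ) 1, I.rate k t * ∫ x, φ t (G.edgePt j x) ∂(σ k j)) +
        ∑ i, (∫ t : Icc (0 : ℝ) 1, I.rate k t * (φ t (G.vertexPt i) * γ k i)) -
        ∫ t : Icc (0 : ℝ) 1, I.rate k t * φ t (G.vertexPt i₀) := by
    intro k
    have h1 : Integrable (fun t : Icc (0 : ℝ) 1 => ∑ j, I.rate k t *
        ∫ x, φ t (G.edgePt j x) ∂(σ k j)) volume := integrable_finsetSum _ fun j _ => hei k j
    have h2 : Integrable (fun t : Icc (0 : ℝ) 1 => ∑ i, I.rate k t *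
        (φ t (G.vertexPt i) * γ k i)) volume := integrable_finsetSum _ fun i _ => hvi k i
    have h12 : Integrable (fun t : Icc (0 : ℝ) 1 => ∑ j, I.rate k t *
        ∫ x, φ t (G.edgePt j x) ∂(σ k j) + ∑ i, I.rate k t *
        (φ t (G.vertexPt i) * γ k i)) volume := h1.add h2
    rw [← integral_finsetSum _ fun j _ => hsi k j, ← integral_finsetSum _ fun j _ => hei k j,
      ← integral_finsetSum _ fun i _ => hvi k i,
      ← integral_add h1 h2, ← integral_sub h12 (hd k)]
    congr 1
    funext t
    simp only [← Finset.mul_sum]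
    rw [hflux k (φ t) fun j => hφ.contDiffOn_edgeCoord j t.2]
    ring
  -- All states are swept to the same vertex `i₀`, so its artificial contribution disappears because
  -- the rates sum to zero.
  have hzero : ∑ k, ∫ t : Icc (0 : ℝ) 1, I.rate k t * φ t (G.vertexPt i₀) = 0 := by
    rw [← integral_finsetSum _ fun k _ => hd k]
    simp only [← Finset.sum_mul, I.sum_rate, zero_mul, integral_zero]
  simp only [hvert, Finset.sum_add_distrib, Finset.sum_sub_distrib]
  have hS : ∑ j, ∑ k, ∫ t : Icc (0 : ℝ) 1, I.rate k t * ∫ x : G.ClosedEdge j,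
        derivWithin (G.edgeCoord (φ t) j) (Icc 0 (G.length j)) x * H k j x =
      ∑ j, ∑ k, (∫ t : Icc (0 : ℝ) 1, I.rate k t * ∫ x, φ t (G.edgePt j x) ∂(σ k j)) +
        ∑ i, ∑ k, (∫ t : Icc (0 : ℝ) 1, I.rate k t * (φ t (G.vertexPt i) * γ k i)) := by
    rw [Finset.sum_comm, Finset.sum_congr rfl fun k _ => hbal k, Finset.sum_sub_distrib, hzero,
      sub_zero, Finset.sum_add_distrib]
    congr 1 <;> exact Finset.sum_comm
  rw [hS]
  ring

/-- The equation at the vertices for an interpolation of mass distributions. -/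
theorem interpolationCurve_vertex_equation (σ : ι → ∀ j, Measure (G.ClosedEdge j))
    [∀ k j, IsFiniteMeasure (σ k j)] (H : ι → ∀ j, G.ClosedEdge j → ℝ) (γ : ι → Fin n → ℝ)
    (i : Fin n) {ψ : ℝ → ℝ} (hψ : ContDiffOn ℝ 1 ψ (Icc 0 1)) :
    ∫ t in (0 : ℝ)..1, derivWithin ψ (Icc 0 1) t * (interpolationCurve I σ H γ).γ i t =
      -(∫ t in (0 : ℝ)..1, ψ t * (interpolationCurve I σ H γ).f i t) +
        (ψ 1 * ∑ k, I.weight k 1 * γ k i - ψ 0 * ∑ k, I.weight k 0 * γ k i) := by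
  have hd : ∀ t, HasDerivAt (fun t => ∑ k, I.weight k t * γ k i) (∑ k, I.rate k t * γ k i) t :=
    fun t => HasDerivAt.fun_sum fun k _ => (I.hasDerivAt k t).mul_const _
  have hc : Continuous fun t => ∑ k, I.rate k t * γ k i :=
    continuous_finsetSum _ fun k _ => (I.continuous_rate k).mul_const _
  have h := intervalIntegral.integral_mul_deriv_eq_deriv_mul_of_hasDerivWithinAt
    (a := 0) (b := 1) (u := ψ) (u' := derivWithin ψ (Icc 0 1))
    (v := fun t => ∑ k, I.weight k t * γ k i) (v' := fun t => ∑ k, I.rate k t * γ k i)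
    (fun t ht => by
      rw [uIcc_of_le zero_le_one] at ht ⊢
      exact hψ.hasDerivWithinAt_Icc ht)
    (fun t _ => (hd t).hasDerivWithinAt)
    (ContinuousOn.intervalIntegrable (by
      rw [uIcc_of_le zero_le_one]
      exact hψ.continuousOn_derivWithin_Icc zero_lt_one))
    (hc.intervalIntegrable _ _)
  simp only [interpolationCurve]
  linarith

end Network

/-! ### Finiteness of the action -/

theorem ae_mem_Ioo_unitInterval :
    ∀ᵐ t : Icc (0 : ℝ) 1, (t : ℝ) ∈ Ioo (0 : ℝ) 1 := by
  have hmeas : MeasurableSet {t : Icc (0 : ℝ) 1 | (t : ℝ) ∉ Ioo (0 : ℝ) 1} :=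
    (measurable_subtype_coe measurableSet_Ioo).compl
  rw [ae_iff, Measure.Subtype.volume_def, Measure.comap_apply _ Subtype.val_injective
    (fun s hs => MeasurableSet.subtype_image measurableSet_Icc hs) _ hmeas]
  refine measure_mono_null (t := {0, 1}) ?_ ((Set.toFinite _).measure_zero _)
  rintro _ ⟨t, ht, rfl⟩
  by_contra h
  simp only [mem_insert_iff, mem_singleton_iff, not_or] at h
  exact ht ⟨lt_of_le_of_ne t.2.1 (Ne.symm h.1), lt_of_le_of_ne t.2.2 h.2⟩

namespace Network

variable {n m : ℕ} {G : Network n m} {ι : Type*} [Fintype ι] (I : Interpolation ι)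

/-- The `k₀` summand alone gives mass density at least `c * I.weight k₀`, while the squared flux is
at most a constant times `I.weight k₀`. The weight cancels in the quotient, whose bound `B` is
integrable on the finite space-time. The other `σ k` may be arbitrarily singular. -/
theorem edgeAction_edgeMass_lt_top {j : Fin m} (σ : ι → Measure (G.ClosedEdge j))
    [∀ k, IsFiniteMeasure (σ k)] {H : ι → G.ClosedEdge j → ℝ} (hH : ∀ k, Measurable (H k))
    {C : ℝ} (hC : ∀ k x, |H k x| ≤ C) {k₀ : ι} {c : ℝ≥0} (hc : 0 < c) (hσ : σ k₀ = c • volume)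
    {K : ℝ} (hK : ∀ t ∈ Ioo (0 : ℝ) 1, ∀ k, I.rate k t ^ 2 ≤ K * I.weight k₀ t)
    (hpos : ∀ t ∈ Ioo (0 : ℝ) 1, 0 < I.weight k₀ t) :
    edgeAction (edgeMass I σ).toSignedMeasure
      (((volume : Measure (Icc (0 : ℝ) 1)).prod volume).withDensityᵥ (edgeFlux I H)) < ⊤ := by
  have hwm : Measurable fun t : Icc (0 : ℝ) 1 => ENNReal.ofReal (I.weight k₀ t) :=
    ((I.continuous_weight k₀).measurable.comp measurable_subtype_coe).ennreal_ofReal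
  have hae : ∀ᵐ z ∂(volume : Measure (Icc (0 : ℝ) 1)).prod (volume : Measure (G.ClosedEdge j)),
      (z.1 : ℝ) ∈ Ioo (0 : ℝ) 1 := Measure.quasiMeasurePreserving_fst.ae ae_mem_Ioo_unitInterval
  refine edgeAction_lt_top _ _ (measurable_edgeFlux I hH) (integrable_edgeFlux I hH hC)
    (β := fun z => c * ENNReal.ofReal (I.weight k₀ z.1))
    ((hwm.comp measurable_fst).const_mul _) (fun z => ENNReal.mul_ne_top (by simp) (by simp))
    ?_ ?_ ?_
  · filter_upwards [hae] with z hz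
    simpa [hc.ne'] using hpos _ hz
  · classical
    have h1 : ((volume : Measure (Icc (0 : ℝ) 1)).prod
        (volume : Measure (G.ClosedEdge j))).withDensity
          (fun z => c * ENNReal.ofReal (I.weight k₀ z.1)) = (I.timeMeasure k₀).prod (σ k₀) := by
      rw [hσ, show c • (volume : Measure (G.ClosedEdge j)) = (c : ℝ≥0∞) • volume from rfl,
        Measure.prod_smul_right, Interpolation.timeMeasure,
        prod_withDensity_left hwm, ← withDensity_smul _
          (show Measurable fun z : G.EdgeSpaceTime j => ENNReal.ofReal (I.weight k₀ z.1) from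
            hwm.comp measurable_fst)]
      rfl
    rw [h1, edgeMass, ← Finset.add_sum_erase _ _ (Finset.mem_univ k₀)]
    exact Measure.le_add_right le_rfl
  · set B : ℝ := (Fintype.card ι : ℝ) ^ 2 * C ^ 2 * K / c with hB
    calc ∫⁻ z, ENNReal.ofReal (edgeFlux I H z ^ 2) / (c * ENNReal.ofReal (I.weight k₀ z.1))
          ∂(volume : Measure (Icc (0 : ℝ) 1)).prod volume
        ≤ ∫⁻ _z, ENNReal.ofReal B ∂(volume : Measure (Icc (0 : ℝ) 1)).prod
          (volume : Measure (G.ClosedEdge j)) := by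
          refine lintegral_mono_ae ?_
          filter_upwards [hae] with z hz
          have hw := hpos _ hz
          have hcr : (0 : ℝ) < c := hc
          have h2 := I.sum_rate_mul_sq_le (hK _ hz) (fun k => hC k z.2)
          rw [← ENNReal.ofReal_coe_nnreal, ← ENNReal.ofReal_mul hcr.le,
            ← ENNReal.ofReal_div_of_pos (mul_pos hcr hw)]
          refine ENNReal.ofReal_le_ofReal ?_
          rw [div_le_iff₀ (mul_pos hcr hw), hB]
          refine h2.trans (le_of_eq ?_)
          field_simp
      _ < ⊤ := by
          rw [lintegral_const]
          exact ENNReal.mul_lt_top ENNReal.ofReal_lt_top (measure_lt_top _ _)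

/-- The same cancellation at a vertex, with `γ k₀` in the role of `c`. The end times, where the
weight may vanish, are discarded as a null set. -/
theorem lintegral_vertexAction_lt_top {γ : ι → ℝ} (hγ : ∀ k, 0 ≤ γ k) {k₀ : ι} (hγ₀ : 0 < γ k₀)
    {K : ℝ} (hK : ∀ t ∈ Ioo (0 : ℝ) 1, ∀ k, I.rate k t ^ 2 ≤ K * I.weight k₀ t)
    (hpos : ∀ t ∈ Ioo (0 : ℝ) 1, 0 < I.weight k₀ t) :
    ∫⁻ t in Icc (0 : ℝ) 1, actionDensity (∑ k, I.weight k t * γ k) (∑ k, I.rate k t * γ k) < ⊤ := by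
  set C := ∑ k, γ k with hC
  have hle : ∀ k, |γ k| ≤ C := fun k => by
    rw [abs_of_nonneg (hγ k)]
    exact Finset.single_le_sum (fun k _ => hγ k) (Finset.mem_univ k)
  set B : ℝ := (Fintype.card ι : ℝ) ^ 2 * C ^ 2 * K / (2 * γ k₀) with hB
  calc ∫⁻ t in Icc (0 : ℝ) 1, actionDensity (∑ k, I.weight k t * γ k) (∑ k, I.rate k t * γ k)
      = ∫⁻ t in Ioo (0 : ℝ) 1, actionDensity (∑ k, I.weight k t * γ k) (∑ k, I.rate k t * γ k) :=
        (setLIntegral_congr Ioo_ae_eq_Icc).symm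
    _ ≤ ∫⁻ _t in Ioo (0 : ℝ) 1, ENNReal.ofReal B := by
        refine setLIntegral_mono measurable_const fun t ht => ?_
        have hw := hpos t ht
        have hw' : I.weight k₀ t * γ k₀ ≤ ∑ k, I.weight k t * γ k :=
          Finset.single_le_sum (f := fun k => I.weight k t * γ k)
            (fun k _ => mul_nonneg (I.weight_nonneg k t (Ioo_subset_Icc_self ht)) (hγ k))
            (Finset.mem_univ k₀)
        have hpos' := (mul_pos hw hγ₀).trans_le hw'
        rw [actionDensity, if_pos hpos']
        refine ENNReal.ofReal_le_ofReal ?_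
        have h2 := I.sum_rate_mul_sq_le (hK t ht) hle
        rw [sq_abs]
        calc (∑ k, I.rate k t * γ k) ^ 2 / (2 * ∑ k, I.weight k t * γ k)
            ≤ (∑ k, I.rate k t * γ k) ^ 2 / (2 * (I.weight k₀ t * γ k₀)) := by gcongr
          _ ≤ ((Fintype.card ι : ℝ) ^ 2 * C ^ 2 * K * I.weight k₀ t) /
                (2 * (I.weight k₀ t * γ k₀)) := by gcongr
          _ = B := by
              rw [hB]
              field_simp
    _ < ⊤ := by
        rw [setLIntegral_const]
        exact ENNReal.mul_lt_top ENNReal.ofReal_lt_top (by simp)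

/-- An interpolation that involves the uniform state with a sufficiently large weight has finite
action. -/
theorem interpolationCurve_action_lt_top (κ : ℝ) (σ : ι → ∀ j, Measure (G.ClosedEdge j))
    [∀ k j, IsFiniteMeasure (σ k j)] {H : ι → ∀ j, G.ClosedEdge j → ℝ} {γ : ι → Fin n → ℝ}
    (hH : ∀ k j, Measurable (H k j)) {C : ℝ} (hC : ∀ k j x, |H k j x| ≤ C)
    (hγ : ∀ k i, 0 ≤ γ k i) {k₀ : ι} {c : ℝ≥0} (hc : 0 < c) (hσ : ∀ j, σ k₀ j = c • volume)
    (hγ₀ : ∀ i, 0 < γ k₀ i) {K : ℝ}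
    (hK : ∀ t ∈ Ioo (0 : ℝ) 1, ∀ k, I.rate k t ^ 2 ≤ K * I.weight k₀ t)
    (hpos : ∀ t ∈ Ioo (0 : ℝ) 1, 0 < I.weight k₀ t) :
    (interpolationCurve I σ H γ).action κ < ⊤ := by
  refine ENNReal.add_lt_top.2 ⟨ENNReal.sum_lt_top.2 fun j _ => ?_,
    ENNReal.mul_lt_top ENNReal.ofReal_lt_top (ENNReal.sum_lt_top.2 fun i _ => ?_)⟩
  · exact edgeAction_edgeMass_lt_top I _ (fun k => hH k j) (fun k => hC k j) hc (hσ j) hK hpos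
  · exact lintegral_vertexAction_lt_top I (fun k => hγ k i) (hγ₀ i) hK hpos

/-- The normalising factor of the uniform distribution, which consists of equal multiples of the
Lebesgue measures on the edges and of the unit masses at the vertices. -/
noncomputable def uniformFactor (G : Network n m) : ℝ≥0 :=
  ((∑ j, G.length j).toNNReal + n)⁻¹

theorem uniformFactor_pos (hn : 0 < n) : 0 < G.uniformFactor := by
  unfold uniformFactor
  positivity

/-- Mass one is what allows the uniform state to be swept to `i₀` on the same footing as the two
given states. -/
theorem sum_uniformFactor (hn : 0 < n) :
    ∑ j, (G.uniformFactor • (volume : Measure (G.ClosedEdge j))).real univ +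
      ∑ _i : Fin n, (G.uniformFactor : ℝ) = 1 := by
  have hL : 0 ≤ ∑ j, G.length j := Finset.sum_nonneg fun j _ => (G.length_pos j).le
  have hvol : ∀ j, (volume : Measure (G.ClosedEdge j)).real univ = G.length j := fun j => by
    rw [Measure.real, Measure.Subtype.volume_univ measurableSet_Icc.nullMeasurableSet,
      Real.volume_Icc, sub_zero, ENNReal.toReal_ofReal (G.length_pos j).le]
  have hpos : 0 < ∑ j, G.length j + (n : ℝ) := by positivity
  simp only [measureReal_nnreal_smul_apply, hvol, ← Finset.mul_sum, Finset.sum_const,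
    Finset.card_univ, Fintype.card_fin, nsmul_eq_mul]
  simp only [uniformFactor, NNReal.coe_inv, NNReal.coe_add, Real.coe_toNNReal _ hL,
    NNReal.coe_natCast]
  field_simp

end Network

/-! ### Conclusion -/

theorem lemma3p3 {n m : ℕ} (G : Network n m) (hG : G.Connected) (κ : ℝ) (hκ : 0 < κ)
    (ρ₀ ρ₁ : ∀ j, MeasureTheory.FiniteMeasure (G.ClosedEdge j)) (γ₀ γ₁ : Fin n → NNReal)
    (h₀ : MeasureTheory.IsProbabilityMeasure (G.totalDensity ρ₀ γ₀))
    (h₁ : MeasureTheory.IsProbabilityMeasure (G.totalDensity ρ₁ γ₁)) :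
    G.W2 κ ρ₀ ρ₁ γ₀ γ₁ < ⊤ := by
  obtain ⟨i₀⟩ := hG.nonempty
  have hn : 0 < n := i₀.pos
  set c := G.uniformFactor with hcdef
  have hc : 0 < c := Network.uniformFactor_pos hn
  -- The order matches the weights `(1 - s)²`, `s²`, `2 s (1 - s)`: initial state, terminal state,
  -- uniform state. Hence `k₀ = 2` in the action bound.
  let σ : Fin 3 → ∀ j, Measure (G.ClosedEdge j) :=
    ![fun j => ρ₀ j, fun j => ρ₁ j, fun _ => c • volume]
  let γ : Fin 3 → Fin n → ℝ := ![fun i => γ₀ i, fun i => γ₁ i, fun _ => c]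
  have hσ : ∀ k j, IsFiniteMeasure (σ k j) := fun k j => by
    fin_cases k
    · exact inferInstanceAs (IsFiniteMeasure (ρ₀ j : Measure (G.ClosedEdge j)))
    · exact inferInstanceAs (IsFiniteMeasure (ρ₁ j : Measure (G.ClosedEdge j)))
    · exact inferInstanceAs (IsFiniteMeasure (c • (volume : Measure (G.ClosedEdge j))))
  have hγ : ∀ k i, 0 ≤ γ k i := fun k i => by
    fin_cases k <;> simp [γ]
  have hmass : ∀ k, ∑ j, (σ k j).real univ + ∑ i, γ k i = 1 := fun k => by
    fin_cases k
    · exact Network.sum_mass_eq_one ρ₀ γ₀ h₀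
    · exact Network.sum_mass_eq_one ρ₁ γ₁ h₁
    · exact Network.sum_uniformFactor hn
  choose H hHm hHb hflux using fun k => hG.exists_flux i₀ (σ k) (γ k) (hmass k)
  choose C hC using hHb
  have hC' : ∀ k j x, |H k j x| ≤ ∑ k, |C k| := fun k j x =>
    ((hC k j x).trans (le_abs_self _)).trans
      (Finset.single_le_sum (f := fun k => |C k|) (fun _ _ => abs_nonneg _) (Finset.mem_univ k))
  set I := smoothInterpolation with hI
  refine lt_of_le_of_lt (iInf₂_le (Network.interpolationCurve I σ H γ) ⟨fun φ hφ => ?_,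
    fun ψ hψ => ?_⟩) (Network.interpolationCurve_action_lt_top I κ σ hHm hC' hγ (k₀ := 2) hc
      (fun j => rfl) (fun i => hc) (fun t ht k => smoothInterpolation_rate_sq_le ht k)
      fun t ht => smoothInterpolation_weight_two_pos ht)
  -- At times `0` and `1` only the weight of the initial, respectively terminal, state survives, so
  -- the boundary terms are the prescribed data.
  · rw [Network.interpolationCurve_edge_equation I σ hHm hC' i₀ hflux hφ]
    refine Finset.sum_congr rfl fun j _ => ?_
    rw [Finset.sum_sub_distrib, hI,
      smoothInterpolation_sum_weight_one fun k => ∫ x, φ 1 (G.edgePt j x) ∂(σ k j),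
      smoothInterpolation_sum_weight_zero fun k => ∫ x, φ 0 (G.edgePt j x) ∂(σ k j)]
    rfl
  · rw [Finset.sum_congr rfl fun i _ =>
      Network.interpolationCurve_vertex_equation I σ H γ i (hψ i), Finset.sum_add_distrib,
      Finset.sum_neg_distrib]
    congr 1
    refine Finset.sum_congr rfl fun i _ => ?_
    rw [hI, smoothInterpolation_sum_weight_one fun k => γ k i,
      smoothInterpolation_sum_weight_zero fun k => γ k i]
    rfl
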